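/- Let $K$ be a field and let $\Lambda=\Lambda(x_i\mid i\ge 0)$ be the Grassmann algebra over $K$ in letters $x_0,x_1,x_2,\dots$. Identify $x_i$ with the operator of left multiplication by $x_i$ on $\Lambda$, and let $\partial_i$ be the odd superderivation of $\Lambda$ with $\partial_i(x_j)=\delta_{ij}$. For $i\ge 0$ put $$v_i=\partial_i+x_ix_{i+1}\big(\partial_{i+2}+x_{i+2}x_{i+3}(\partial_{i+4}+x_{i+4}x_{i+5}(\partial_{i+6}+\cdots))\big)\in\operatorname{End}\Lambda ,$$ which is well defined because only finitely many summands act nontrivially on a given element of $\Lambda$. Let $\mathbf A=\operatorname{Alg}(v_0,v_1)\subset\operatorname{End}\Lambda$ be the associative subalgebra (without unit) generated by $v_0$ and $v_1$. Let $\mathcal B$ be the following family of monomials (operators on $\Lambda$), indexed by their length $n$ and all their exponents, where all exponents $\xi_i,\alpha_i$ lie in $\{0,1\}$: * length $0$: $v_0$; * length $1$: $v_1v_0^{\alpha_0}$; * length $2$: $x_0^{\xi_0}x_1^{\xi_1}v_2v_1^{\alpha_1}v_0^{\alpha_0}$ with $\xi_0+\xi_1\le 1$; * length $n\ge 3$: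 $x_0^{\xi_0}x_1^{\xi_1}\cdots x_{n-1}^{\xi_{n-1}}\,v_n\,v_{n-1}^{\alpha_{n-1}}v_{n-2}^{\alpha_{n-2}}\cdots v_0^{\alpha_0}$ with $\xi_{n-2}+\xi_{n-1}\le 1+\alpha_{n-1}$, where for $n=3$ it is additionally required that the monomials with $\xi_0=\xi_2=1$ are only those of the form $x_0x_2v_3v_2v_1^{\alpha_1}v_0^{\alpha_0}$ (that is, $\xi_1=0$ and $\alpha_2=1$). Then: (i) if $\operatorname{char}K\ne 2$, then $\mathcal B$ is a basis of $\mathbf A$, i.e. the family $\mathcal B$ is linearly independent and its linear span is $\mathbf A$; (ii) if $\operatorname{char}K=2$, then $\mathbf A$ is contained in the linear span of $\mathcal B$; (iii) for every field $K$, the monomials of $\mathcal B$ with $\xi_{n-1}=0$, where $n$ is the length of the monomial (no condition for $n=0$), are linearly independent and belong to $\mathbf A$. -/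

import Mathlib

noncomputable section

namespace PivotHull

/-- The Grassmann algebra `Λ = Λ(x_i | i ≥ 0)` in countably many letters. -/
abbrev Grassmann (K : Type*) [Field K] : Type _ := ExteriorAlgebra K (ℕ →₀ K)

/-- The Grassmann letter `x_i`. -/
def letter (K : Type*) [Field K] (i : ℕ) : Grassmann K :=
  ExteriorAlgebra.ι K (Finsupp.single i (1 : K))

/-- The letter `x_i`, regarded as the operator of left multiplication on `Λ`. -/
def X (K : Type*) [Field K] (i : ℕ) : Module.End K (Grassmann K) :=
  LinearMap.mulLeft K (letter K i)

/-- The odd superderivative `∂_i` of `Λ`, i.e. the left contraction with the `i`-th coordinate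
functional: `∂_i 1 = 0`, and `∂_i (x_j a) = δ_{ij} a - x_j ∂_i a`. -/
def D (K : Type*) [Field K] (i : ℕ) : Module.End K (Grassmann K) :=
  CliffordAlgebra.contractLeft (Q := (0 : QuadraticForm K (ℕ →₀ K))) (Finsupp.lapply i)

theorem D_letter_mul (K : Type*) [Field K] (i j : ℕ) (a : Grassmann K) :
    D K i (letter K j * a) = (if i = j then a else 0) - letter K j * D K i a := by
  have h := CliffordAlgebra.contractLeft_ι_mul (Q := (0 : QuadraticForm K (ℕ →₀ K)))
    (Finsupp.lapply i) (Finsupp.single j (1 : K)) a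
  refine h.trans ?_
  congr 1
  by_cases hij : i = j
  · subst hij; simp
  · simp [hij]

theorem D_one (K : Type*) [Field K] (i : ℕ) : D K i 1 = 0 :=
  CliffordAlgebra.contractLeft_one (Q := (0 : QuadraticForm K (ℕ →₀ K))) (Finsupp.lapply i)

/-- Every element of `Λ` is annihilated by almost all `∂_i`. -/
theorem finite_D_ne_zero (K : Type*) [Field K] (a : Grassmann K) :
    {i : ℕ | D K i a ≠ 0}.Finite := by
  induction a using CliffordAlgebra.left_induction with
  | algebraMap r =>
    refine Set.finite_empty.subset ?_
    intro i hi
    exact hi (CliffordAlgebra.contractLeft_algebraMap (Q := (0 : QuadraticForm K (ℕ →₀ K)))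
      (Finsupp.lapply i) r)
  | add a b ha hb =>
    refine (ha.union hb).subset ?_
    intro i hi
    by_contra hc
    simp only [Set.mem_union, Set.mem_ofPred_eq, not_or, not_not] at hc
    exact hi (by rw [map_add, hc.1, hc.2, add_zero])
  | ι_mul a m ha =>
    refine (ha.union m.support.finite_toSet).subset ?_
    intro i hi
    by_contra hc
    simp only [Set.mem_union, Set.mem_ofPred_eq, not_or, not_not, Finset.mem_coe,
      Finsupp.mem_support_iff] at hc
    refine hi ((CliffordAlgebra.contractLeft_ι_mul _ _ _).trans ?_)
    have h1 : (Finsupp.lapply i : (ℕ →₀ K) →ₗ[K] K) m = 0 := hc.2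
    have h2 : CliffordAlgebra.contractLeft (Q := (0 : QuadraticForm K (ℕ →₀ K)))
      (Finsupp.lapply i) a = 0 := hc.1
    rw [h1, h2]; simp

/-- The `k`-th summand `x_i x_{i+1} ⋯ x_{i+2k-1} ∂_{i+2k}` of the pivot element `v_i`. -/
def pivotTerm (K : Type*) [Field K] (i k : ℕ) : Module.End K (Grassmann K) :=
  ((List.range (2 * k)).map fun j => X K (i + j)).prod * D K (i + 2 * k)

theorem finite_pivotTerm (K : Type*) [Field K] (i : ℕ) (a : Grassmann K) :
    (Function.support fun k => pivotTerm K i k a).Finite := by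
  refine ((finite_D_ne_zero K a).preimage
    (f := fun k => i + 2 * k) (fun k _ l _ h => by simpa using h)).subset ?_
  intro k hk h0
  refine hk ?_
  change ((List.range (2 * k)).map fun j => X K (i + j)).prod (D K (i + 2 * k) a) = 0
  rw [h0, map_zero]

/-- The pivot element
`v_i = ∂_i + x_i x_{i+1} (∂_{i+2} + x_{i+2} x_{i+3} (∂_{i+4} + ⋯))` as an operator on `Λ`.
The sum is infinite, but only finitely many summands act nontrivially on a given element. -/
def v (K : Type*) [Field K] (i : ℕ) : Module.End K (Grassmann K) where
  toFun a := ∑ᶠ k : ℕ, pivotTerm K i k a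
  map_add' a b := by
    simp only [map_add]
    exact finsum_add_distrib (finite_pivotTerm K i a) (finite_pivotTerm K i b)
  map_smul' c a := by
    simp only [map_smul, RingHom.id_apply]
    exact (smul_finsum' c (finite_pivotTerm K i a)).symm

/-- The associative hull `A = Alg(v_0, v_1) ⊂ End Λ`: the associative subalgebra (without unit)
generated by `v_0` and `v_1`. -/
def hull (K : Type*) [Field K] : NonUnitalSubalgebra K (Module.End K (Grassmann K)) :=
  NonUnitalAlgebra.adjoin K {v K 0, v K 1}

/-- The exponents of a formal monomial
`x_0^{ξ_0} ⋯ x_{n-1}^{ξ_{n-1}} v_n v_{n-1}^{α_{n-1}} ⋯ v_0^{α_0}` of length `n`.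
Exponents with index at least `n` do not occur and are set to zero. -/
@[ext]
structure Exponents where
  n : ℕ
  ξ : ℕ → Fin 2
  α : ℕ → Fin 2
  ξ_eq_zero : ∀ i, n ≤ i → ξ i = 0
  α_eq_zero : ∀ i, n ≤ i → α i = 0

/-- The operator `x_0^{ξ_0} ⋯ x_{n-1}^{ξ_{n-1}} v_n v_{n-1}^{α_{n-1}} ⋯ v_0^{α_0}`. -/
def monomial (K : Type*) [Field K] (w : Exponents) : Module.End K (Grassmann K) :=
  ((List.range w.n).map fun i => X K i ^ (w.ξ i : ℕ)).prod * v K w.n *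
    ((List.range w.n).reverse.map fun i => v K i ^ (w.α i : ℕ)).prod

/-- The monomials in the list: `v_0`; `v_1 v_0^*`; `x_0^{ξ_0} x_1^{ξ_1} v_2 v_1^* v_0^*` with
`ξ_0 + ξ_1 ≤ 1`; and, for `n ≥ 3`, those with `ξ_{n-2} + ξ_{n-1} ≤ 1 + α_{n-1}`, where for
`n = 3` the monomials containing both `x_0` and `x_2` are only `x_0 x_2 v_3 v_2 v_1^* v_0^*`. -/
def Listed (w : Exponents) : Prop :=
  w.n = 0 ∨
  (w.n = 1 ∧ w.ξ 0 = 0) ∨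
  (w.n = 2 ∧ (w.ξ 0 : ℕ) + (w.ξ 1 : ℕ) ≤ 1) ∨
  (3 ≤ w.n ∧ (w.ξ (w.n - 2) : ℕ) + (w.ξ (w.n - 1) : ℕ) ≤ 1 + (w.α (w.n - 1) : ℕ) ∧
    (w.n = 3 → w.ξ 0 = 1 → w.ξ 2 = 1 → w.ξ 1 = 0 ∧ w.α 2 = 1))

/-- The condition `ξ_{n-1} = 0` (void for `n = 0`). -/
def NoNeck (w : Exponents) : Prop := ∀ i, i + 1 = w.n → w.ξ i = 0

end PivotHull

end

/-! The two comparisons between the hull and the span use only the relations of `PivotSystem`. These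
give `v_i² = x_{i+1} v_{i+2}`, `v_i v_{i+1} = -v_{i+1} v_i - x_i v_{i+2}` and `v_i v_{i+2} + v_{i+2}
v_i = 2 x_i x_{i+1} x_{i+3} v_{i+4}`.

The hull lies in the span because the span contains `v_0` and `v_1` and is stable under right
multiplication by both. Straightening with the first two relations creates new letters, so stability
is proved in a stronger form, for every partial product `v_n ⋯ v_k`, by descending induction on `k`
(`closed_tail`).

Conversely, a letter can be deleted from a word before `v_n` without leaving the hull, since `v_i
x_i + x_i v_i = 1` and `x_i v_i` commutes with the rest (`mem_of_letters_cons`). So it suffices to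
produce the longest words. The second relation gives those without `x_{n-1}`. For `n ≥ 4` the third
gives those with `x_{n-1}`, after division by 2; this is the only place where the characteristic
enters. If `x_{n-1}` and a conflicting letter both occur, the factor `v_{n-1}` is present and the
monomial splits into a product.

Independence holds for all monomials, listed or not. With `x_i` of weight `2^i`, every `v_i` is
homogeneous of weight `-2^i`, and uniqueness of binary expansions makes the evaluations
`leadingValue` triangular. -/

namespace PivotHull

/-! ### Formal consequences of the Clifford relations -/

section Relations

variable {R : Type*} [Ring R]

/-- Operators `X_i`, `D_i` satisfying the relations of the Clifford superalgebra, together with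
pivot elements `v_i = D_i + X_i X_{i+1} v_{i+2}` which anticommute with the operators of smaller
index. -/
structure PivotSystem (X D v : ℕ → R) : Prop where
  X_swap : ∀ i j, X i * X j = -(X j * X i)
  X_sq : ∀ i, X i * X i = 0
  D_X : ∀ i, D i * X i = 1 - X i * D i
  D_X_ne : ∀ i j, i ≠ j → D i * X j = -(X j * D i)
  D_sq : ∀ i, D i * D i = 0
  v_eq : ∀ i, v i = D i + X i * X (i + 1) * v (i + 2)
  v_X_lt : ∀ i j, j < i → v i * X j = -(X j * v i)
  v_D_lt : ∀ i j, j < i → v i * D j = -(D j * v i)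

/-- The product of the elements `X i` along a list of indices. -/
def letters (X : ℕ → R) (l : List ℕ) : R := (l.map X).prod

@[simp] theorem letters_nil (X : ℕ → R) : letters X [] = 1 := rfl

@[simp] theorem letters_cons (X : ℕ → R) (i : ℕ) (l : List ℕ) :
    letters X (i :: l) = X i * letters X l := by simp [letters]

@[simp] theorem letters_append (X : ℕ → R) (l l' : List ℕ) :
    letters X (l ++ l') = letters X l * letters X l' := by simp [letters]

/-- If `f` anticommutes with every letter of `l`, then it commutes with their product up to a
sign. -/
theorem mul_letters {X : ℕ → R} {f : R} {l : List ℕ} (h : ∀ i ∈ l, f * X i = -(X i * f)) :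
    f * letters X l = (-1) ^ l.length * (letters X l * f) := by
  induction l with
  | nil => simp
  | cons i l ih =>
    rw [letters_cons, ← mul_assoc, h i (by simp), neg_mul, mul_assoc,
      ih fun j hj => h j (by simp [hj]), List.length_cons, pow_succ, mul_assoc, mul_assoc,
      neg_one_mul, ← mul_assoc (X i), ← ((Commute.one_left (X i)).neg_left.pow_left l.length).eq,
      mul_assoc, mul_neg]

theorem mul_letters_or {X : ℕ → R} {f : R} {l : List ℕ} (h : ∀ i ∈ l, f * X i = -(X i * f)) :
    f * letters X l = letters X l * f ∨ f * letters X l = -(letters X l * f) := by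
  rw [mul_letters h]
  rcases neg_one_pow_eq_or R l.length with h | h <;> simp [h]

theorem commute_letters {X : ℕ → R} {f : R} {l : List ℕ} (h : ∀ i ∈ l, Commute f (X i)) :
    Commute f (letters X l) := by
  induction l with
  | nil => simp
  | cons i l ih =>
    rw [letters_cons]
    exact (h i (by simp)).mul_right (ih fun j hj => h j (by simp [hj]))

namespace PivotSystem

variable {X D v : ℕ → R}

theorem letters_perm (P : PivotSystem X D v) {l l' : List ℕ} (h : l.Perm l') :
    letters X l = letters X l' ∨ letters X l = -letters X l' := by
  induction h with
  | nil => simp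
  | cons x _ ih => rcases ih with h | h <;> simp [h]
  | swap x y l =>
    right
    simp only [letters_cons, ← mul_assoc]
    rw [P.X_swap y x, neg_mul]
  | trans _ _ ih₁ ih₂ => rcases ih₁ with h | h <;> rcases ih₂ with h' | h' <;> simp [h, h']

theorem letters_eq_zero (P : PivotSystem X D v) {l : List ℕ} (h : ¬l.Nodup) : letters X l = 0 := by
  obtain ⟨i, hi⟩ := List.exists_duplicate_iff_not_nodup.2 h
  obtain ⟨l', hl'⟩ := (List.duplicate_iff_sublist.1 hi).exists_perm_append
  have h0 : letters X ([i, i] ++ l') = 0 := by simp [← mul_assoc, P.X_sq]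
  rcases P.letters_perm hl' with h | h <;> rw [h, h0]
  exact neg_zero

theorem X_swap_assoc (P : PivotSystem X D v) (i j : ℕ) (z : R) :
    X i * (X j * z) = -(X j * (X i * z)) := by
  rw [← mul_assoc, P.X_swap, neg_mul, mul_assoc]

/-- An oriented form of the swap: under the side condition, rewriting sorts letters increasingly and
terminates. -/
theorem X_lt_assoc (P : PivotSystem X D v) {i j : ℕ} (_ : j < i) (z : R) :
    X i * (X j * z) = -(X j * (X i * z)) :=
  P.X_swap_assoc i j z

theorem X_sq_assoc (P : PivotSystem X D v) (i : ℕ) (z : R) : X i * (X i * z) = 0 := by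
  rw [← mul_assoc, P.X_sq, zero_mul]

theorem D_X_assoc (P : PivotSystem X D v) (i : ℕ) (z : R) :
    D i * (X i * z) = z - X i * (D i * z) := by
  rw [← mul_assoc, P.D_X, sub_mul, one_mul, mul_assoc]

theorem D_X_ne_assoc (P : PivotSystem X D v) (i j : ℕ) (h : i ≠ j) (z : R) :
    D i * (X j * z) = -(X j * (D i * z)) := by
  rw [← mul_assoc, P.D_X_ne i j h, neg_mul, mul_assoc]

theorem v_X_lt_assoc (P : PivotSystem X D v) (i j : ℕ) (h : j < i) (z : R) :
    v i * (X j * z) = -(X j * (v i * z)) := by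
  rw [← mul_assoc, P.v_X_lt i j h, neg_mul, mul_assoc]

theorem X_v (P : PivotSystem X D v) (i : ℕ) : X i * v i = X i * D i := by
  rw [P.v_eq]
  simp only [mul_add, mul_assoc, P.X_sq_assoc, add_zero]

theorem v_X (P : PivotSystem X D v) (i : ℕ) : v i * X i = 1 - X i * v i := by
  rw [P.X_v, P.v_eq]
  simp (disch := omega) only [add_mul, mul_assoc, P.D_X, P.v_X_lt, mul_neg, X_lt_assoc P,
    P.X_sq_assoc, add_zero, neg_zero]

theorem v_X_assoc (P : PivotSystem X D v) (i : ℕ) (z : R) :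
    v i * (X i * z) = z - X i * (v i * z) := by
  rw [← mul_assoc, P.v_X, sub_mul, one_mul, mul_assoc]

/-- The squares of both summands of `v i` vanish; of the cross terms only the `1` in `D i * X i = 1
- X i * D i` survives. -/
theorem v_sq (P : PivotSystem X D v) (i : ℕ) : v i * v i = X (i + 1) * v (i + 2) := by
  rw [P.v_eq i]
  simp (disch := omega) only [add_mul, mul_add, mul_assoc, P.D_X_ne_assoc, P.D_X_assoc,
    P.v_X_lt_assoc, P.v_D_lt, mul_neg, P.X_lt_assoc, P.X_sq_assoc, P.D_sq, neg_zero, mul_zero]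
  abel

theorem v_sq_assoc (P : PivotSystem X D v) (i : ℕ) (z : R) :
    v i * (v i * z) = X (i + 1) * (v (i + 2) * z) := by
  rw [← mul_assoc, P.v_sq, mul_assoc]

/-- Two pivot elements do not anticommute in general, but `X j * v j = X j * D j`, and both factors
anticommute with `v i`. -/
theorem X_v_v_lt (P : PivotSystem X D v) {i j : ℕ} (h : j < i) :
    X j * (v j * v i) = -(X j * (v i * v j)) := by
  have h' : X j * (v i * v j) = -(v i * (X j * v j)) := by
    rw [← mul_assoc, ← mul_assoc, P.v_X_lt i j h, neg_mul, neg_neg]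
  rw [h', neg_neg, P.X_v, ← mul_assoc, P.X_v, mul_assoc, P.v_X_lt_assoc i j h, P.v_D_lt i j h]
  simp only [mul_neg, neg_neg]

theorem v_v_succ (P : PivotSystem X D v) (i : ℕ) :
    v i * v (i + 1) = -(v (i + 1) * v i) - X i * v (i + 2) := by
  have h := P.X_v_v_lt (show i + 1 < i + 2 by omega)
  rw [P.v_eq i]
  simp (disch := omega) only [add_mul, mul_add, mul_assoc, P.v_X_lt_assoc, P.v_D_lt, P.v_X_assoc,
    mul_neg, mul_sub, h]
  abel

/-- The `D i` parts cancel, while `X i * X (i + 1)` commutes with `v (i + 2)`, so both orders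
contribute the same term `X i * X (i + 1) * v (i + 2)²`. -/
theorem v_v_add_two (P : PivotSystem X D v) (i : ℕ) :
    v i * v (i + 2) = -(v (i + 2) * v i) + 2 * (X i * (X (i + 1) * (X (i + 3) * v (i + 4)))) := by
  rw [P.v_eq i]
  simp (disch := omega) only [add_mul, mul_add, mul_assoc, P.v_X_lt_assoc, P.v_D_lt, P.v_sq,
    mul_neg, two_mul]
  abel

/-- `X_j v_j` commutes with the other letters. -/
theorem commute_X_v_X (P : PivotSystem X D v) {i j : ℕ} (h : i ≠ j) :
    Commute (X j * v j) (X i) := by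
  rw [P.X_v, commute_iff_eq, mul_assoc, P.D_X_ne j i h.symm, mul_neg, P.X_swap_assoc i]

/-- `X_j v_j` commutes with the pivot elements of larger index. -/
theorem commute_X_v_v (P : PivotSystem X D v) {i j : ℕ} (h : j < i) :
    Commute (X j * v j) (v i) := by
  rw [commute_iff_eq, mul_assoc, P.X_v_v_lt h, P.v_X_lt_assoc i j h]

theorem v_letters (P : PivotSystem X D v) {n : ℕ} {l : List ℕ} (h : ∀ i ∈ l, i < n) :
    v n * letters X l = letters X l * v n ∨ v n * letters X l = -(letters X l * v n) :=
  mul_letters_or fun i hi => P.v_X_lt n i (h i hi)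

end PivotSystem

end Relations

/-! ### The operators on the Grassmann algebra satisfy the relations -/

section Operators

variable {K : Type*} [Field K]

theorem X_mul_X_swap (i j : ℕ) : X K i * X K j = -(X K j * X K i) := by
  refine LinearMap.ext fun a => ?_
  change letter K i * (letter K j * a) = -(letter K j * (letter K i * a))
  have h : letter K i * letter K j + letter K j * letter K i = 0 :=
    ExteriorAlgebra.ι_add_mul_swap _ _
  rw [← mul_assoc, ← mul_assoc, eq_neg_of_add_eq_zero_left h]
  exact neg_mul _ _

theorem X_mul_X_self (i : ℕ) : X K i * X K i = 0 := by
  refine LinearMap.ext fun a => ?_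
  change letter K i * (letter K i * a) = 0
  rw [← mul_assoc, letter, ExteriorAlgebra.ι_sq_zero, zero_mul]

theorem D_mul_D_self (i : ℕ) : D K i * D K i = 0 :=
  LinearMap.ext fun a => CliffordAlgebra.contractLeft_contractLeft
    (Q := (0 : QuadraticForm K (ℕ →₀ K))) (Finsupp.lapply i) a

theorem D_mul_D_swap (i j : ℕ) : D K i * D K j = -(D K j * D K i) :=
  LinearMap.ext fun _ => CliffordAlgebra.contractLeft_comm _ _ _

theorem D_mul_X_self (i : ℕ) : D K i * X K i = 1 - X K i * D K i :=
  LinearMap.ext fun a => (D_letter_mul K i i a).trans (by rw [if_pos rfl]; rfl)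

theorem D_mul_X_of_ne {i j : ℕ} (h : i ≠ j) : D K i * X K j = -(X K j * D K i) :=
  LinearMap.ext fun a => (D_letter_mul K i j a).trans (by rw [if_neg h]; exact zero_sub _)

theorem pivotTerm_eq (i k : ℕ) :
    pivotTerm K i k = letters (X K) ((List.range (2 * k)).map (i + ·)) * D K (i + 2 * k) := by
  rw [pivotTerm, letters, List.map_map]; rfl

theorem pivotTerm_zero (i : ℕ) : pivotTerm K i 0 = D K i := by simp [pivotTerm]

theorem pivotTerm_succ (i k : ℕ) :
    pivotTerm K i (k + 1) = X K i * X K (i + 1) * pivotTerm K (i + 2) k := by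
  rw [pivotTerm, pivotTerm, show 2 * (k + 1) = 2 * k + 1 + 1 by ring, List.range_succ_eq_map,
    List.range_succ_eq_map]
  simp only [List.map_cons, List.map_map, List.prod_cons, Nat.add_zero, mul_assoc, Nat.zero_add,
    Nat.succ_eq_add_one]
  congr 3
  · congr 2
    funext j
    simp only [Function.comp]
    congr 1; omega
  · congr 1; omega

theorem v_apply (i : ℕ) (a : Grassmann K) : v K i a = ∑ᶠ k : ℕ, pivotTerm K i k a := rfl

/-- The recursion `v_i = ∂_i + x_i x_{i+1} v_{i+2}`. -/
theorem v_eq_add (i : ℕ) : v K i = D K i + X K i * X K (i + 1) * v K (i + 2) := by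
  refine LinearMap.ext fun a => ?_
  obtain ⟨N, hN⟩ := (finite_pivotTerm K i a).bddAbove
  obtain ⟨M, hM⟩ := (finite_pivotTerm K (i + 2) a).bddAbove
  rw [LinearMap.add_apply, Module.End.mul_apply, v_apply, v_apply,
    -- Both sums are truncated beyond both supports; the first range is longer by one because its `k
    -- = 0` term is `∂_i`.
    finsum_eq_sum_of_support_subset (s := Finset.range (N + M + 1 + 1)) _ fun k hk => by
      have := hN hk; simp; omega,
    finsum_eq_sum_of_support_subset (s := Finset.range (N + M + 1)) _ fun k hk => by
      have := hM hk; simp; omega,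
    Finset.sum_range_succ', pivotTerm_zero, map_sum, add_comm]
  simp only [pivotTerm_succ]
  rfl

/-- An operator intertwining all the summands of `v_i` intertwines `v_i`. -/
theorem v_mul_of_pivotTerm {i : ℕ} {f g : Module.End K (Grassmann K)}
    (h : ∀ k, pivotTerm K i k * f = g * pivotTerm K i k) : v K i * f = g * v K i := by
  refine LinearMap.ext fun a => ?_
  rw [Module.End.mul_apply, Module.End.mul_apply, v_apply, v_apply]
  rw [show g (∑ᶠ k, pivotTerm K i k a) = ∑ᶠ k, g (pivotTerm K i k a) from
    g.toAddMonoidHom.map_finsum (finite_pivotTerm K i a)]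
  exact finsum_congr fun k => LinearMap.congr_fun (h k) a

/-- An element anticommuting with the factors of `L * d`, where `L` is a product of an even number
of letters, anticommutes with `L * d`. -/
theorem even_letters_mul_swap {R : Type*} [Ring R] {X : ℕ → R} {f d : R} {l : List ℕ}
    (hl : Even l.length) (h : ∀ i ∈ l, f * X i = -(X i * f)) (hd : d * f = -(f * d)) :
    letters X l * d * f = -f * (letters X l * d) := by
  have h := mul_letters h
  rw [hl.neg_one_pow, one_mul] at h
  rw [mul_assoc, hd, mul_neg, ← mul_assoc, ← h, neg_mul, mul_assoc]

/-- Each summand of `v_i` is odd: an even number of letters and one `∂_m` with `m ≥ i > j`. -/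
theorem v_mul_X_of_lt {i j : ℕ} (h : j < i) : v K i * X K j = -(X K j * v K i) := by
  refine (v_mul_of_pivotTerm (g := -X K j) fun k => ?_).trans rfl
  rw [pivotTerm_eq]
  exact even_letters_mul_swap (by simp) (fun m _ => X_mul_X_swap j m) (D_mul_X_of_ne (by omega))

theorem v_mul_D_of_lt {i j : ℕ} (h : j < i) : v K i * D K j = -(D K j * v K i) := by
  refine (v_mul_of_pivotTerm (g := -D K j) fun k => ?_).trans rfl
  rw [pivotTerm_eq]
  refine even_letters_mul_swap (by simp) (fun m hm => D_mul_X_of_ne ?_) (D_mul_D_swap _ _)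
  simp only [List.mem_map, List.mem_range] at hm
  omega

theorem pivotSystem (K : Type*) [Field K] : PivotSystem (X K) (D K) (v K) where
  X_swap := X_mul_X_swap
  X_sq := X_mul_X_self
  D_X := D_mul_X_self
  D_X_ne _ _ h := D_mul_X_of_ne h
  D_sq := D_mul_D_self
  v_eq := v_eq_add
  v_X_lt _ _ h := v_mul_X_of_lt h
  v_D_lt _ _ h := v_mul_D_of_lt h

end Operators

end PivotHull

namespace PivotHull

/-! ### The span of the listed monomials is stable under right multiplication -/

section Closure

variable {R : Type*} [Ring R]

/-- The sets of letters which may precede the pivot element `v_n` in the listed monomials of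
length `n`; the Boolean `ε` records whether `v_{n-1}` occurs. -/
def Admissible (n : ℕ) (ε : Bool) (l : List ℕ) : Prop :=
  (∀ i ∈ l, i < n) ∧ (n = 1 → 0 ∉ l) ∧ (n = 2 → 0 ∈ l → 1 ∉ l) ∧
    (3 ≤ n → ε = false → n - 2 ∈ l → n - 1 ∉ l) ∧
    (n = 3 → 0 ∈ l → 2 ∈ l → 1 ∉ l ∧ ε = true)

/-- The products `v_n v_{n-1}^{α_{n-1}} ⋯ v_k^{α_k}`; the Boolean is the exponent `α_{n-1}`. -/
inductive Tail (v : ℕ → R) (n : ℕ) : Bool → ℕ → R → Prop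
  | top : Tail v n false n (v n)
  | neck {k : ℕ} (h : k + 1 = n) : Tail v n true k (v n * v k)
  | skip {ε : Bool} {k : ℕ} {t : R} (h : Tail v n ε (k + 1) t) : Tail v n ε k t
  | app {ε : Bool} {k : ℕ} {t : R} (hk : k + 1 < n) (h : Tail v n ε (k + 1) t) :
      Tail v n ε k (t * v k)

theorem Tail.le {v : ℕ → R} {n k : ℕ} {ε : Bool} {t : R} (h : Tail v n ε k t) : k ≤ n := by
  induction h <;> omega

/-- Inversion with explicit equations, usable when the indices are numerals or sums. -/
theorem Tail.cases' {v : ℕ → R} {n k : ℕ} {ε : Bool} {t : R} (h : Tail v n ε k t) :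
    (k = n ∧ ε = false ∧ t = v n) ∨ (k + 1 = n ∧ ε = true ∧ t = v n * v k) ∨
      (k < n ∧ Tail v n ε (k + 1) t) ∨
      (k + 1 < n ∧ ∃ t', Tail v n ε (k + 1) t' ∧ t = t' * v k) := by
  cases h with
  | top => simp
  | neck h => simp [h]
  | skip h => exact Or.inr (Or.inr (Or.inl ⟨h.le, h⟩))
  | app hk h => exact Or.inr (Or.inr (Or.inr ⟨hk, _, h, rfl⟩))

theorem Tail.eq_top {v : ℕ → R} {n : ℕ} {ε : Bool} {t : R} (h : Tail v n ε n t) :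
    ε = false ∧ t = v n := by
  rcases h.cases' with h | h | h | h
  · exact h.2
  · omega
  · omega
  · omega

theorem Tail.eq_neck {v : ℕ → R} {k : ℕ} {ε : Bool} {t : R} (h : Tail v (k + 1) ε k t) :
    (ε = false ∧ t = v (k + 1)) ∨ (ε = true ∧ t = v (k + 1) * v k) := by
  rcases h.cases' with h | h | h | h
  · omega
  · exact Or.inr h.2
  · exact Or.inl h.2.eq_top
  · omega

variable (K : Type*) [Field K] [Algebra K R]

/-- The span of the listed monomials without the pivot elements `v_j`, `j < k`. -/
def listedSpan (X v : ℕ → R) (k : ℕ) : Submodule K R :=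
  Submodule.span K {a | ∃ n ε l t, Admissible n ε l ∧ Tail v n ε k t ∧ a = letters X l * t}

variable {K} {X D v : ℕ → R}

theorem mem_listedSpan {n k : ℕ} {ε : Bool} {l : List ℕ} {t : R} (hl : Admissible n ε l)
    (ht : Tail v n ε k t) : letters X l * t ∈ listedSpan K X v k :=
  Submodule.subset_span ⟨n, ε, l, t, hl, ht, rfl⟩

theorem mem_listedSpan₁ {n k i : ℕ} {ε : Bool} {l : List ℕ} {t : R}
    (hl : Admissible n ε (l ++ [i])) (ht : Tail v n ε k t) :
    letters X l * (X i * t) ∈ listedSpan K X v k := by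
  simpa [mul_assoc] using mem_listedSpan (X := X) (K := K) hl ht

theorem mem_listedSpan₂ {n k i j : ℕ} {ε : Bool} {l : List ℕ} {t : R}
    (hl : Admissible n ε (l ++ [i, j])) (ht : Tail v n ε k t) :
    letters X l * (X i * (X j * t)) ∈ listedSpan K X v k := by
  simpa [mul_assoc] using mem_listedSpan (X := X) (K := K) hl ht

theorem mem_listedSpan₃ {n k i j m : ℕ} {ε : Bool} {l : List ℕ} {t : R}
    (hl : Admissible n ε (l ++ [i, j, m])) (ht : Tail v n ε k t) :
    letters X l * (X i * (X j * (X m * t))) ∈ listedSpan K X v k := by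
  simpa [mul_assoc] using mem_listedSpan (X := X) (K := K) hl ht

theorem Admissible.mono {n : ℕ} {l : List ℕ} (h : Admissible n false l) : Admissible n true l := by
  simp only [Admissible] at *
  grind

theorem listedSpan_mono (k : ℕ) : listedSpan K X v (k + 1) ≤ listedSpan K X v k := by
  refine Submodule.span_mono ?_
  rintro a ⟨n, ε, l, t, hl, ht, rfl⟩
  exact ⟨n, ε, l, t, hl, ht.skip, rfl⟩

theorem listedSpan_mul_v {k : ℕ} {a : R} (ha : a ∈ listedSpan K X v (k + 1)) :
    a * v k ∈ listedSpan K X v k := by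
  induction ha using Submodule.span_induction with
  | mem a ha =>
    obtain ⟨n, ε, l, t, hl, ht, rfl⟩ := ha
    rw [mul_assoc]
    rcases ht.le.lt_or_eq with h | rfl
    · exact mem_listedSpan hl (ht.app h)
    · obtain ⟨rfl, rfl⟩ := ht.eq_top
      exact mem_listedSpan hl.mono (.neck rfl)
  | zero => simp
  | add a b _ _ ha hb => rw [add_mul]; exact add_mem ha hb
  | smul c a _ ha => rw [smul_mul_assoc]; exact Submodule.smul_mem _ _ ha

namespace PivotSystem

theorem tail_mul_X (P : PivotSystem X D v) {n k j : ℕ} {ε : Bool} {t : R} (ht : Tail v n ε k t)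
    (hj : j < k) : t * X j = X j * t ∨ t * X j = -(X j * t) := by
  induction ht with
  | top => exact Or.inr (P.v_X_lt _ _ hj)
  | neck h =>
    left
    rw [mul_assoc, P.v_X_lt _ _ hj, mul_neg, ← mul_assoc, P.v_X_lt _ _ (by omega)]
    noncomm_ring
  | skip h ih => exact ih (by omega)
  | app hk h ih =>
    rw [mul_assoc, P.v_X_lt _ _ hj, mul_neg, ← mul_assoc]
    rcases ih (by omega) with h | h <;> rw [h] <;> simp [mul_assoc]

theorem v_X_v_succ (P : PivotSystem X D v) (n : ℕ) :
    v n * (X n * v (n + 1)) = v (n + 1) + X n * (v (n + 1) * v n) := by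
  rw [P.v_X_assoc, P.v_v_succ, mul_sub, P.X_sq_assoc]
  noncomm_ring

theorem v_succ_v_v (P : PivotSystem X D v) (m : ℕ) :
    v (m + 1) * v m * v m = v (m + 2) + X (m + 1) * (v (m + 2) * v (m + 1)) := by
  rw [mul_assoc, P.v_sq, P.v_X_v_succ]

theorem v_succ_v_v_succ (P : PivotSystem X D v) (m : ℕ) :
    v (m + 1) * v m * v (m + 1) = -(X (m + 2) * (v (m + 3) * v m)) -
      X m * (v (m + 2) * v (m + 1)) - X m * (X (m + 1) * v (m + 3)) := by
  rw [mul_assoc, P.v_v_succ, mul_sub, mul_neg, P.v_sq_assoc, P.v_X_lt_assoc _ _ (by omega),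
    P.v_v_succ]
  noncomm_ring

theorem v_succ_v_X_v_succ (P : PivotSystem X D v) (m : ℕ) :
    v (m + 1) * v m * (X m * v (m + 1)) =
      X (m + 2) * v (m + 3) - X m * (X (m + 2) * (v (m + 3) * v m)) := by
  rw [mul_assoc, P.v_X_assoc, mul_sub, P.v_sq, P.v_X_lt_assoc _ _ (by omega), ← mul_assoc (v _),
    P.v_succ_v_v_succ]
  simp only [mul_sub, P.X_sq_assoc]
  noncomm_ring

/-- The claims about right multiplication of one monomial. -/
def Closed (K : Type*) [Field K] [Algebra K R] (X v : ℕ → R) (n : ℕ) (ε : Bool) (k : ℕ) (t : R) :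
    Prop :=
  ∀ l, Admissible n ε l →
    letters X l * (t * v k) ∈ listedSpan K X v k ∧
    letters X l * (t * v (k + 1)) ∈ listedSpan K X v k ∧
    (1 ≤ k → letters X l * (t * (X k * v (k + 1))) ∈ listedSpan K X v k)

theorem closed_top (P : PivotSystem X D v) (n : ℕ) : Closed K X v n false n (v n) := by
  refine fun l hl => ⟨?_, ?_, fun hn => ?_⟩
  · rw [P.v_sq]
    exact mem_listedSpan₁ (by simp only [Admissible] at *; grind) Tail.top.skip.skip
  · rw [P.v_v_succ, mul_sub, mul_neg]
    refine sub_mem (neg_mem (mem_listedSpan ?_ (.neck rfl)))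
      (mem_listedSpan₁ ?_ Tail.top.skip.skip) <;> (simp only [Admissible] at *; grind)
  · rw [P.v_X_v_succ, mul_add]
    refine add_mem (mem_listedSpan ?_ Tail.top.skip)
      (mem_listedSpan₁ ?_ (.neck rfl)) <;> (simp only [Admissible] at *; grind)

theorem closed_neck (P : PivotSystem X D v) (m : ℕ) :
    Closed K X v (m + 1) true m (v (m + 1) * v m) := by
  refine fun l hl => ⟨?_, ?_, fun hn => ?_⟩
  · rw [P.v_succ_v_v, mul_add]
    refine add_mem (mem_listedSpan ?_ Tail.top.skip.skip)
      (mem_listedSpan₁ ?_ (Tail.neck rfl).skip) <;> (simp only [Admissible] at *; grind)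
  · rw [P.v_succ_v_v_succ, mul_sub, mul_sub, mul_neg]
    refine sub_mem (sub_mem (neg_mem (mem_listedSpan₁ ?_ (.app ?_ Tail.top.skip.skip)))
      (mem_listedSpan₁ ?_ (Tail.neck rfl).skip)) (mem_listedSpan₂ ?_ Tail.top.skip.skip.skip) <;>
      (simp only [Admissible] at *; grind)
  · rw [P.v_succ_v_X_v_succ, mul_sub]
    refine sub_mem (mem_listedSpan₁ ?_ Tail.top.skip.skip.skip)
      (mem_listedSpan₂ ?_ (.app ?_ Tail.top.skip.skip)) <;> (simp only [Admissible] at *; grind)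

theorem closed_top_skip (P : PivotSystem X D v) (m : ℕ) :
    Closed K X v (m + 1) false m (v (m + 1)) := by
  refine fun l hl => ⟨?_, ?_, fun hn => ?_⟩
  · exact mem_listedSpan hl.mono (.neck rfl)
  · rw [P.v_sq]
    exact mem_listedSpan₁ (by simp only [Admissible] at *; grind) Tail.top.skip.skip.skip
  · rw [P.v_X_lt_assoc _ _ (by omega), P.v_sq, mul_neg]
    exact neg_mem (mem_listedSpan₂ (by simp only [Admissible] at *; grind) Tail.top.skip.skip.skip)

/-- A pair of pivot elements of indices `k`, `k + 1` or `k`, `k + 2` multiplied on the right,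
with the letter `X_k` between them. -/
theorem letter_mul_mem (P : PivotSystem X D v) {n k : ℕ} {ε : Bool} {t : R}
    (ht : Tail v n ε (k + 1) t) (hkn : k + 1 < n) (ih : Closed K X v n ε (k + 1) t) {l : List ℕ}
    (hl : Admissible n ε l) :
    letters X l * (X k * (t * v (k + 2))) ∈ listedSpan K X v (k + 1) ∧
    (1 ≤ k → letters X l * (X k * (t * v (k + 1))) ∈ listedSpan K X v (k + 1)) := by
  have key : ∀ z, letters X l * (X k * z) = letters X (l ++ [k]) * z := fun z => by
    simp [mul_assoc]
  -- If `X k` may join the word, the inductive hypothesis applies to the enlarged word. Only the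
  -- obstructed cases need computation.
  by_cases h : Admissible n ε (l ++ [k])
  · rw [key, key]
    exact ⟨(ih _ h).2.1, fun _ => (ih _ h).1⟩
  by_cases hn : n = k + 2
  -- Here `X k` is the letter of index `n - 2`. Straightening yields greater lengths, or the same
  -- length with `v (n - 1)` present, and there the letter is allowed.
  · subst hn
    rcases ht.eq_neck with ⟨rfl, rfl⟩ | ⟨rfl, rfl⟩
    · refine ⟨?_, fun _ => ?_⟩
      · rw [P.v_sq]
        exact mem_listedSpan₂ (by simp only [Admissible] at *; grind) Tail.top.skip.skip.skip
      · exact mem_listedSpan₁ (by simp only [Admissible] at *; grind) (.neck rfl)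
    · refine ⟨?_, fun _ => ?_⟩
      · rw [P.v_succ_v_v_succ, key, mul_sub, mul_sub, mul_neg]
        refine sub_mem (sub_mem (neg_mem (mem_listedSpan₁ ?_ (.app ?_ Tail.top.skip.skip)))
          (mem_listedSpan₁ ?_ (Tail.neck rfl).skip))
          (mem_listedSpan₂ ?_ Tail.top.skip.skip.skip) <;> (simp only [Admissible] at *; grind)
      · rw [P.v_succ_v_v, key, mul_add]
        refine add_mem (mem_listedSpan ?_ Tail.top.skip.skip)
          (mem_listedSpan₁ ?_ (Tail.neck rfl).skip) <;> (simp only [Admissible] at *; grind)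
  -- The remaining obstruction is the extra condition for length 3, when `X 0` joins `X 2`. The tail
  -- is then `v 3`, `v 3 * v 2`, `v 3 * v 1` or `v 3 * v 2 * v 1`, and each product with `v 2` is
  -- straightened explicitly.
  · have h3 : k = 0 ∧ n = 3 := by
      simp only [Admissible, List.mem_append, List.mem_singleton] at *
      have hk : n - 2 ≠ k ∧ n - 1 ≠ k ∧ ¬n = 1 ∧ ¬n = 2 := by omega
      grind (splits := 20)
    obtain ⟨rfl, rfl⟩ := h3
    refine ⟨?_, fun h => absurd h (by omega)⟩
    have h1 : v 3 * v 2 * v 2 = v 4 + X 3 * (v 4 * v 3) := P.v_succ_v_v 2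
    have h2 : v 3 * v 2 * v 3 = -(X 4 * (v 5 * v 2)) - X 2 * (v 4 * v 3) - X 2 * (X 3 * v 5) :=
      P.v_succ_v_v_succ 2
    have h3 : v 3 * v 3 = X 4 * v 5 := P.v_sq 3
    have h4 : v 1 * v 2 = -(v 2 * v 1) - X 1 * v 3 := P.v_v_succ 1
    simp only [zero_add] at ht ⊢
    rcases ht.cases' with h' | h' | ⟨-, h'⟩ | ⟨-, t, h', rfl⟩
    · omega
    · omega
    · rcases h'.eq_neck with ⟨rfl, rfl⟩ | ⟨rfl, rfl⟩
      · exact mem_listedSpan₁ (by simp only [Admissible] at *; grind) (Tail.neck rfl).skip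
      · rw [h1, mul_add, mul_add]
        refine add_mem (mem_listedSpan₁ ?_ Tail.top.skip.skip.skip)
          (mem_listedSpan₂ ?_ (Tail.neck rfl).skip.skip) <;> (simp only [Admissible] at *; grind)
    · rcases h'.eq_neck with ⟨rfl, rfl⟩ | ⟨rfl, rfl⟩
      · have e : v 3 * v 1 * v 2 = X 1 * (X 4 * v 5) - v 3 * v 2 * v 1 := by
          rw [mul_assoc, h4, mul_sub, P.v_X_lt_assoc _ _ (by omega), h3]
          noncomm_ring
        rw [e, mul_sub, mul_sub]
        refine sub_mem (mem_listedSpan₃ ?_ Tail.top.skip.skip.skip.skip)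
          (mem_listedSpan₁ ?_ (.app ?_ (Tail.neck rfl))) <;> (simp only [Admissible] at *; grind)
      · have e : v 3 * v 2 * v 1 * v 2 = -(v 4 * v 1) - X 3 * (v 4 * v 3 * v 1)
            + X 1 * (X 4 * (v 5 * v 2)) + X 1 * (X 2 * (v 4 * v 3))
            + X 1 * (X 2 * (X 3 * v 5)) := by
          have h5 : v 3 * v 2 * (X 1 * v 3) = X 1 * (v 3 * v 2 * v 3) := by
            rw [mul_assoc, P.v_X_lt_assoc _ _ (by omega), mul_neg,
              P.v_X_lt_assoc _ _ (by omega), neg_neg, mul_assoc]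
          rw [mul_assoc, h4, mul_sub, h5, mul_neg, ← mul_assoc, h1, h2]
          noncomm_ring
        rw [e]
        simp only [key, mul_add, mul_sub, mul_neg]
        refine add_mem (add_mem (add_mem (sub_mem (neg_mem (mem_listedSpan ?_
          (.app ?_ Tail.top.skip.skip))) (mem_listedSpan₁ ?_ (.app ?_ (Tail.neck rfl).skip)))
          (mem_listedSpan₂ ?_ (Tail.skip (.app ?_ Tail.top.skip.skip))))
          (mem_listedSpan₂ ?_ (Tail.neck rfl).skip.skip))
          (mem_listedSpan₃ ?_ Tail.top.skip.skip.skip.skip) <;>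
          (simp only [Admissible] at *; grind)

/-- The three claims of `Closed` feed each other: `v k * v k = X (k + 1) * v (k + 2)` calls for the
third claim one level up, and exchanging `v k` with `v (k + 1)` leaves a letter `X k` to be moved to
the left. The third claim is restricted to `k ≥ 1` since `v 0 * X 0 * v 1` produces the unlisted `X
0 * v 1 * v 0`; the induction only calls it at `k + 1`. -/
theorem closed_tail (P : PivotSystem X D v) {n k : ℕ} {ε : Bool} {t : R} (ht : Tail v n ε k t) :
    Closed K X v n ε k t := by
  induction ht with
  | top => exact P.closed_top n
  | @neck k h => subst h; exact P.closed_neck k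
  | @skip ε k t ht ih =>
    rcases ht.le.lt_or_eq with h | rfl
    · refine fun l hl => ⟨mem_listedSpan hl (ht.app h), listedSpan_mono k (ih l hl).1, fun hk => ?_⟩
      have h2 := listedSpan_mono k ((P.letter_mul_mem ht h ih hl).2 hk)
      rw [← mul_assoc t]
      rcases P.tail_mul_X ht k.lt_succ_self with e | e <;> rw [e]
      · rwa [mul_assoc]
      · rw [neg_mul, mul_neg, mul_assoc]; exact neg_mem h2
    · obtain ⟨rfl, rfl⟩ := ht.eq_top
      exact P.closed_top_skip k
  | @app ε k t h ht ih =>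
    intro l hl
    have h1 := listedSpan_mul_v (ih l hl).1
    have h2 := listedSpan_mono k (P.letter_mul_mem ht h ih hl).1
    have e1 : t * v k * v (k + 1) = -(t * v (k + 1) * v k) - t * X k * v (k + 2) := by
      rw [mul_assoc, P.v_v_succ]; noncomm_ring
    have e2 : t * v k * (X k * v (k + 1)) = t * v (k + 1) + t * X k * v (k + 1) * v k := by
      rw [mul_assoc, P.v_X_assoc, P.v_v_succ, mul_sub, mul_sub, P.X_sq_assoc]; noncomm_ring
    refine ⟨?_, ?_, fun hk => ?_⟩
    · rw [mul_assoc t, P.v_sq]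
      exact listedSpan_mono k ((ih l hl).2.2 (by omega))
    · rw [e1, mul_sub, mul_neg, ← mul_assoc _ (_ * _)]
      refine sub_mem (neg_mem h1) ?_
      rcases P.tail_mul_X ht k.lt_succ_self with e | e <;> rw [e]
      · rwa [mul_assoc]
      · rw [neg_mul, mul_neg, mul_assoc]; exact neg_mem h2
    · have h3 := listedSpan_mul_v ((P.letter_mul_mem ht h ih hl).2 hk)
      rw [e2, mul_add]
      refine add_mem (listedSpan_mono k (ih l hl).1) ?_
      rcases P.tail_mul_X ht k.lt_succ_self with e | e <;> rw [e]
      · simpa only [mul_assoc] using h3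
      · simpa only [mul_assoc, neg_mul, mul_neg] using neg_mem h3

theorem listedSpan_mul (P : PivotSystem X D v) {a : R} (ha : a ∈ listedSpan K X v 0) :
    a * v 0 ∈ listedSpan K X v 0 ∧ a * v 1 ∈ listedSpan K X v 0 := by
  induction ha using Submodule.span_induction with
  | mem a ha =>
    obtain ⟨n, ε, l, t, hl, ht, rfl⟩ := ha
    have h := P.closed_tail (K := K) ht l hl
    rw [mul_assoc, mul_assoc]
    exact ⟨h.1, h.2.1⟩
  | zero => simp
  | add a b _ _ ha hb =>
    rw [add_mul, add_mul]; exact ⟨add_mem ha.1 hb.1, add_mem ha.2 hb.2⟩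
  | smul c a _ ha =>
    rw [smul_mul_assoc, smul_mul_assoc]
    exact ⟨Submodule.smul_mem _ _ ha.1, Submodule.smul_mem _ _ ha.2⟩

theorem adjoin_le_listedSpan (P : PivotSystem X D v) :
    (NonUnitalAlgebra.adjoin K {v 0, v 1}).toSubmodule ≤ listedSpan K X v 0 := by
  have h0 : v 0 ∈ listedSpan K X v 0 := by
    simpa using mem_listedSpan (K := K) (X := X) (l := []) (by simp [Admissible])
      (Tail.top (v := v) (n := 0))
  have h1 : v 1 ∈ listedSpan K X v 0 := by
    simpa using mem_listedSpan (K := K) (X := X) (l := []) (by simp [Admissible])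
      (Tail.top (v := v) (n := 1)).skip
  -- Membership alone does not pass to products; stability under right multiplication by `a` does.
  suffices h : ∀ a ∈ NonUnitalAlgebra.adjoin K {v 0, v 1}, a ∈ listedSpan K X v 0 ∧
      ∀ b ∈ listedSpan K X v 0, b * a ∈ listedSpan K X v 0 from fun a ha => (h a ha).1
  intro a ha
  induction ha using NonUnitalAlgebra.adjoin_induction with
  | mem a ha =>
    rcases ha with rfl | rfl
    · exact ⟨h0, fun b hb => (P.listedSpan_mul hb).1⟩
    · exact ⟨h1, fun b hb => (P.listedSpan_mul hb).2⟩
  | add a b _ _ ha hb =>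
    exact ⟨add_mem ha.1 hb.1, fun c hc => by rw [mul_add]; exact add_mem (ha.2 c hc) (hb.2 c hc)⟩
  | zero => simp
  | mul a b _ _ ha hb =>
    exact ⟨hb.2 a ha.1, fun c hc => by rw [← mul_assoc]; exact hb.2 _ (ha.2 c hc)⟩
  | smul r a _ ha =>
    exact ⟨Submodule.smul_mem _ _ ha.1, fun c hc => by
      rw [mul_smul_comm]; exact Submodule.smul_mem _ _ (ha.2 c hc)⟩

end PivotSystem

end Closure

end PivotHull

namespace PivotHull

/-! ### The listed monomials lie in the hull -/

section Membership

variable {R : Type*} [Ring R] {K : Type*} [Field K] [Algebra K R] {X D v : ℕ → R}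

namespace PivotSystem

/-- Membership of `letters X l * t` in a set closed under negation depends only on the multiset of
letters. -/
theorem letters_mul_mem_of_perm (P : PivotSystem X D v) {S : Type*} [SetLike S R]
    [NegMemClass S R] {A : S} {l l' : List ℕ} (h : l.Perm l') {t : R}
    (ht : letters X l' * t ∈ A) : letters X l * t ∈ A := by
  rcases P.letters_perm h with e | e <;> rw [e]
  · exact ht
  · rw [neg_mul]; exact neg_mem ht

theorem letters_mul_mem_of_nodup (P : PivotSystem X D v) {A : NonUnitalSubalgebra K R}
    {l : List ℕ} {t : R} (h : l.Nodup → letters X l * t ∈ A) : letters X l * t ∈ A := by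
  by_cases hl : l.Nodup
  · exact h hl
  · rw [P.letters_eq_zero hl, zero_mul]; exact zero_mem A

theorem v_mem (P : PivotSystem X D v) {A : NonUnitalSubalgebra K R} (h0 : v 0 ∈ A) (h1 : v 1 ∈ A)
    (i : ℕ) : v i ∈ A := by
  induction i using Nat.strong_induction_on with
  | _ i ih =>
    match i with
    | 0 => exact h0
    | 1 => exact h1
    | i + 2 =>
      -- The commutator of `v (i + 1)` with `v i² = X (i + 1) * v (i + 2)` removes the letter.
      have e : v (i + 2) = v (i + 1) * (v i * v i) - v i * v i * v (i + 1) := by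
        rw [P.v_sq, P.v_X_v_succ]; noncomm_ring
      rw [e]
      have h := ih i (by omega)
      have h' := ih (i + 1) (by omega)
      exact sub_mem (mul_mem h' (mul_mem h h)) (mul_mem (mul_mem h h) h')

variable {A : NonUnitalSubalgebra K R}

theorem X_succ_v_mem (P : PivotSystem X D v) (hA : ∀ i, v i ∈ A) (i : ℕ) :
    X (i + 1) * v (i + 2) ∈ A := by
  rw [← P.v_sq]; exact mul_mem (hA i) (hA i)

theorem X_v_mem (P : PivotSystem X D v) (hA : ∀ i, v i ∈ A) (i : ℕ) : X i * v (i + 2) ∈ A := by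
  have e : X i * v (i + 2) = -(v (i + 1) * v i) - v i * v (i + 1) := by
    rw [P.v_v_succ]; noncomm_ring
  rw [e]
  exact sub_mem (neg_mem (mul_mem (hA _) (hA _))) (mul_mem (hA _) (hA _))

/-- Insert `1 = v i * X i + X i * v i` before the word. As `X i * v i` commutes with the word and
with `v n`, it can be moved to the right end; both terms then contain the longer word times `v n`,
up to sign, multiplied by `v i` on one side. -/
theorem mem_of_letters_cons (P : PivotSystem X D v) (hA : ∀ i, v i ∈ A) {i n : ℕ} {l : List ℕ}
    (hi : i ∉ l) (hn : i < n) (h : letters X (i :: l) * v n ∈ A) : letters X l * v n ∈ A := by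
  have hc : Commute (X i * v i) (letters X l * v n) :=
    (commute_letters fun j hj => P.commute_X_v_X (by rintro rfl; exact hi hj)).mul_right
      (P.commute_X_v_v hn)
  have e : letters X l * v n =
      v i * (letters X (i :: l) * v n) + letters X l * v n * X i * v i := by
    rw [letters_cons, mul_assoc, P.v_X_assoc, mul_assoc _ (X i), ← hc.eq]; noncomm_ring
  have e' : letters X l * v n * X i = letters X (i :: l) * v n ∨
      letters X l * v n * X i = -(letters X (i :: l) * v n) := by
    rw [mul_assoc, P.v_X_lt _ _ hn, letters_cons, mul_neg, ← mul_assoc]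
    rcases mul_letters_or (l := l) fun j _ => P.X_swap i j with e | e <;> rw [e]
    · exact Or.inr rfl
    · exact Or.inl (neg_mul _ _).symm
  rw [e]
  refine add_mem (mul_mem (hA i) h) (mul_mem ?_ (hA i))
  rcases e' with e' | e' <;> rw [e']
  · exact h
  · exact neg_mem h

theorem letters_mul_mem_of_append (P : PivotSystem X D v) (hA : ∀ i, v i ∈ A) {n : ℕ}
    {c l : List ℕ} (hn : ∀ i ∈ c, i < n) (hnd : (c ++ l).Nodup)
    (h : letters X (c ++ l) * v n ∈ A) : letters X l * v n ∈ A := by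
  induction c with
  | nil => simpa using h
  | cons i c ih =>
    rw [List.cons_append] at hnd h
    rw [List.nodup_cons] at hnd
    exact ih (fun j hj => hn j (by simp [hj])) hnd.2
      (P.mem_of_letters_cons hA hnd.1 (hn i (by simp)) h)

/-- Letters of index less than `n` may be removed. -/
theorem letters_mul_mem_of_subset (P : PivotSystem X D v) (hA : ∀ i, v i ∈ A) {n : ℕ}
    {L l : List ℕ} (hn : ∀ i ∈ L, i < n) (hL : L.Nodup) (hl : ∀ i ∈ l, i ∈ L)
    (h : letters X L * v n ∈ A) : letters X l * v n ∈ A := by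
  refine P.letters_mul_mem_of_nodup fun hnd => ?_
  obtain ⟨l', hl', hs⟩ := hnd.subperm hl
  obtain ⟨c, hc⟩ := hs.exists_perm_append
  have hp : L.Perm (c ++ l) := hc.trans (List.perm_append_comm.trans (hl'.append_left c))
  exact P.letters_mul_mem_of_append hA (fun i hi => hn i (hp.mem_iff.2 (by simp [hi])))
    (hp.nodup_iff.1 hL) (P.letters_mul_mem_of_perm hp.symm h)

/-- The relation for `v (m + 1) * v (m + 2)` supplies the next letter, because `v (m + 1)` passes
the smaller letters up to sign. -/
theorem letters_range_mul_mem (P : PivotSystem X D v) (hA : ∀ i, v i ∈ A) (m : ℕ) :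
    letters X (List.range (m + 1)) * v (m + 2) ∈ A := by
  induction m with
  | zero => simpa using P.X_v_mem hA 0
  | succ m ih =>
    have e : letters X (List.range (m + 2)) * v (m + 3) =
        -(letters X (List.range (m + 1)) * v (m + 2) * v (m + 1)) -
          letters X (List.range (m + 1)) * v (m + 1) * v (m + 2) := by
      rw [mul_assoc _ (v (m + 1)), P.v_v_succ, List.range_succ (n := m + 1), letters_append]
      simp only [letters_cons, letters_nil]
      noncomm_ring
    rw [e]
    refine sub_mem (neg_mem (mul_mem ih (hA _))) ?_
    rcases P.v_letters (n := m + 1) (l := List.range (m + 1)) (by simp) with e | e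
    · rw [← e, mul_assoc]; exact mul_mem (hA _) ih
    · rw [← neg_neg (letters X _ * v (m + 1)), ← e, neg_mul, mul_assoc]
      exact neg_mem (mul_mem (hA _) ih)

theorem letters_mul_mem (P : PivotSystem X D v) (hA : ∀ i, v i ∈ A) {n : ℕ} {l : List ℕ}
    (hl : ∀ i ∈ l, i + 1 < n) : letters X l * v n ∈ A := by
  match n with
  | 0 | 1 =>
    have : l = [] := List.eq_nil_iff_forall_not_mem.2 fun i hi => absurd (hl i hi) (by omega)
    simpa [this] using hA _
  | n + 2 =>
    exact P.letters_mul_mem_of_subset hA (L := List.range (n + 1))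
      (fun i hi => by have := List.mem_range.1 hi; omega) List.nodup_range
      (fun i hi => List.mem_range.2 (by have := hl i hi; omega)) (P.letters_range_mul_mem hA n)

/-- Multiplying `v_v_add_two` by `x_0 ⋯ x_{m-1}` gives twice the longest such word; the others
follow by deleting letters. -/
theorem letters_neck_mul_mem (P : PivotSystem X D v) (hA : ∀ i, v i ∈ A) (h2 : (2 : K) ≠ 0)
    {m : ℕ} {l : List ℕ} (hl : ∀ i ∈ l, i < m + 2) :
    letters X (l ++ [m + 3]) * v (m + 4) ∈ A := by
  have h : letters X (List.range (m + 2) ++ [m + 3]) * v (m + 4) ∈ A := by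
    have hm : letters X (List.range m) * v (m + 2) ∈ A :=
      P.letters_mul_mem hA fun i hi => by have := List.mem_range.1 hi; omega
    have e : (2 : K) • (letters X (List.range (m + 2) ++ [m + 3]) * v (m + 4)) =
        letters X (List.range m) * v m * v (m + 2) +
          letters X (List.range m) * v (m + 2) * v m := by
      rw [mul_assoc _ (v m), P.v_v_add_two, List.range_succ, List.range_succ, two_smul]
      simp only [letters_append, letters_cons, letters_nil]
      noncomm_ring
    have h' : (2 : K) • (letters X (List.range (m + 2) ++ [m + 3]) * v (m + 4)) ∈ A := by
      rw [e]
      refine add_mem ?_ (mul_mem hm (hA _))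
      rcases P.v_letters (n := m) (l := List.range m) (by simp) with e | e
      · rw [← e, mul_assoc]; exact mul_mem (hA _) hm
      · rw [← neg_neg (letters X _ * v m), ← e, neg_mul, mul_assoc]
        exact neg_mem (mul_mem (hA _) hm)
    have := SMulMemClass.smul_mem (2 : K)⁻¹ h'
    rwa [smul_smul, inv_mul_cancel₀ h2, one_smul] at this
  refine P.letters_mul_mem_of_subset hA (n := m + 4) ?_ ?_ ?_ h
  · intro i hi; simp at hi; omega
  · rw [List.nodup_append]
    refine ⟨List.nodup_range, by simp, ?_⟩
    intro a ha b hb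
    simp at ha hb; omega
  · intro i hi
    simp only [List.mem_append, List.mem_range, List.mem_singleton] at hi ⊢
    exact hi.imp_left (hl i)

/-- The case of no pivot elements after `v_n`. -/
theorem letters_mul_v_mem (P : PivotSystem X D v) (hA : ∀ i, v i ∈ A) {n : ℕ} {l : List ℕ}
    (h2 : (2 : K) ≠ 0 ∨ n - 1 ∉ l) (hl : Admissible n false l) : letters X l * v n ∈ A := by
  by_cases hn : n - 1 ∈ l
  swap
  · refine P.letters_mul_mem hA fun i hi => ?_
    have h1 := hl.1 i hi
    have : i ≠ n - 1 := by rintro rfl; exact hn hi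
    omega
  have h2' := h2.resolve_right (not_not.2 hn)
  refine P.letters_mul_mem_of_nodup fun hnd => ?_
  have hp := (List.perm_cons_erase hn).trans (List.perm_append_singleton _ _).symm
  have hc : ∀ i ∈ l.erase (n - 1), i + 1 < n ∧ i ∈ l := fun i hi => by
    have h := (hnd.mem_erase_iff).1 hi
    have := hl.1 i h.2
    exact ⟨by omega, h.2⟩
  refine P.letters_mul_mem_of_perm hp ?_
  have h1 := hl.1 _ hn
  match n with
  | 1 => exact absurd hn (hl.2.1 rfl)
  | 2 | 3 =>
    have : l.erase _ = [] := List.eq_nil_iff_forall_not_mem.2 fun i hi => by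
      have h := hc i hi
      simp only [Admissible] at hl
      have hi : i = 0 ∨ i = 1 := by omega
      rcases hi with rfl | rfl <;> grind
    rw [this]
    simpa using P.X_succ_v_mem hA _
  | m + 4 =>
    refine P.letters_neck_mul_mem hA h2' fun i hi => ?_
    have h := hc i hi
    simp only [Admissible] at hl
    have hne : i ≠ m + 2 := by rintro rfl; grind
    omega

theorem letters_append_pair_mem (P : PivotSystem X D v) {n j : ℕ} {l : List ℕ}
    (h : letters X (l ++ [n]) * v (n + 1) ∈ A) (hj : X j * v n ∈ A) (hn : j < n + 1) :
    letters X (l ++ [n, j]) * (v (n + 1) * v n) ∈ A := by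
  have e : letters X (l ++ [n, j]) * (v (n + 1) * v n) =
      -(letters X (l ++ [n]) * v (n + 1) * (X j * v n)) := by
    rw [mul_assoc _ (v (n + 1)), P.v_X_lt_assoc _ _ hn]
    simp [mul_assoc]
  rw [e]
  exact neg_mem (mul_mem h hj)

/-- The listed monomials belong to every subalgebra containing the pivot elements; in
characteristic two this is claimed only for the monomials without `x_{n-1}`. -/
theorem letters_mul_tail_mem (P : PivotSystem X D v) (hA : ∀ i, v i ∈ A) {n k : ℕ} {ε : Bool}
    {t : R} {l : List ℕ} (h2 : (2 : K) ≠ 0 ∨ n - 1 ∉ l) (hl : Admissible n ε l)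
    (ht : Tail v n ε k t) : letters X l * t ∈ A := by
  induction ht with
  | top => exact P.letters_mul_v_mem hA h2 hl
  | @neck k hk =>
    subst hk
    by_cases hf : Admissible (k + 1) false l
    · rw [← mul_assoc]
      exact mul_mem (P.letters_mul_v_mem hA h2 hf) (hA k)
    refine P.letters_mul_mem_of_nodup fun hnd => ?_
    have hk : k ∈ l := by simp only [Admissible] at *; grind
    have h2' : (2 : K) ≠ 0 ∨ k + 1 - 1 ∉ [k] := by simpa [hk] using h2
    -- `X j` is the letter in conflict with `X k`; it is split off together with `v k`. Normally `j
    -- = k - 1`, with `X j * v k = v (k - 2)²`; for length 3 with `X 0` present it is `j = 0`.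
    obtain ⟨j, hj, hjk, hjA, hc⟩ : ∃ j ∈ l, j ≠ k ∧ X j * v k ∈ A ∧
        ∀ i ∈ l, i ≠ k → i ≠ j → i + 1 < k ∧ k ≠ 2 := by
      by_cases h3 : k = 2 ∧ 0 ∈ l
      · obtain ⟨rfl, h0⟩ := h3
        refine ⟨0, h0, by simp, P.X_v_mem hA 0, fun i hi hi1 hi2 => ?_⟩
        have := hl.1 i hi
        have : i = 1 := by omega
        simp only [Admissible] at *; grind
      · have hk2 : 2 ≤ k ∧ k - 1 ∈ l := by simp only [Admissible] at *; grind
        obtain ⟨m, rfl⟩ := Nat.exists_eq_add_of_le' hk2.1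
        refine ⟨m + 1, hk2.2, by omega, P.X_succ_v_mem hA m, fun i hi hi1 hi2 => ?_⟩
        have := hl.1 i hi
        refine ⟨by omega, fun hm => h3 ⟨hm, ?_⟩⟩
        obtain rfl : i = 0 := by omega
        exact hi
    have hj' : j ∈ l.erase k := hnd.mem_erase_iff.2 ⟨hjk, hj⟩
    have hp : l.Perm ((l.erase k).erase j ++ [k, j]) :=
      ((List.perm_cons_erase hk).trans ((List.perm_cons_erase hj').cons k)).trans
        (List.perm_append_comm (l₁ := [k, j]))
    refine P.letters_mul_mem_of_perm hp (P.letters_append_pair_mem ?_ hjA (hl.1 j hj))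
    have hc' : ∀ i ∈ (l.erase k).erase j, i ∈ l ∧ i ≠ k ∧ i ≠ j := fun i hi => by
      have h1 := (hnd.erase k).mem_erase_iff.1 hi
      have h2 := hnd.mem_erase_iff.1 h1.2
      exact ⟨h2.2, h2.1, h1.1⟩
    refine P.letters_mul_v_mem hA (h2.imp_right fun h => absurd hk h) ?_
    have hc'' : ∀ i ∈ (l.erase k).erase j, i + 1 < k ∧ k ≠ 2 := fun i hi =>
      hc i (hc' i hi).1 (hc' i hi).2.1 (hc' i hi).2.2
    have hk0 : k ≠ 0 := by rintro rfl; exact hl.2.1 rfl hk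
    have hk1 : k ≠ 1 := by
      rintro rfl
      have := hl.1 j hj
      obtain rfl : j = 0 := by omega
      exact hl.2.2.1 rfl hj hk
    clear hf hl h2
    simp only [Admissible, List.mem_append, List.mem_singleton]
    refine ⟨?_, ?_, ?_, ?_, ?_⟩
    · rintro i (hi | rfl)
      · have := hc'' i hi; omega
      · omega
    · omega
    · omega
    · rintro - - (hi | hi)
      · have := hc'' _ hi; omega
      · omega
    · rintro h3 (hi | hi)
      · have := hc'' _ hi; omega
      · omega
  | skip h ih => exact ih hl
  | @app ε k t hk h ih =>
    rw [← mul_assoc]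
    exact mul_mem (ih hl) (hA k)

end PivotSystem

end Membership

end PivotHull

namespace PivotHull

/-! ### Exponent sequences and products of pivot elements -/

section Tails

theorem prod_map_pow {R : Type*} [Monoid R] (f : ℕ → R) (e : ℕ → Fin 2) (L : List ℕ) :
    (L.map fun i => f i ^ (e i : ℕ)).prod = ((L.filter fun i => e i = 1).map f).prod := by
  induction L with
  | nil => rfl
  | cons i L ih =>
    rcases Fin.exists_fin_two.1 ⟨e i, rfl⟩ with h | h <;> simp [h, ih]

variable {R : Type*} [Ring R] {v : ℕ → R}

theorem tail_of_exponents (α : ℕ → Fin 2) (m : ℕ) : ∀ k : ℕ,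
    Tail v (k + m) (m ≠ 0 ∧ α (k + m - 1) = 1 : Bool) k
      (v (k + m) * ((List.range' k m).reverse.map fun i => v i ^ (α i : ℕ)).prod) := by
  induction m with
  | zero => intro k; simpa using Tail.top (v := v) (n := k)
  | succ m ih =>
    intro k
    have h := ih (k + 1)
    rw [show k + 1 + m = k + (m + 1) by ring] at h
    have e : v (k + (m + 1)) * ((List.range' k (m + 1)).reverse.map fun i => v i ^ (α i : ℕ)).prod =
        v (k + (m + 1)) * ((List.range' (k + 1) m).reverse.map fun i => v i ^ (α i : ℕ)).prod *
          v k ^ (α k : ℕ) := by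
      simp [List.range'_succ, mul_assoc]
    rw [e]
    rcases m.eq_zero_or_pos with rfl | hm
    · rcases Fin.exists_fin_two.1 ⟨α k, rfl⟩ with h' | h'
      · simpa [h'] using Tail.top.skip
      · simpa [h'] using Tail.neck rfl
    · have hm' : m ≠ 0 := by omega
      simp only [ne_eq, hm', not_false_eq_true, true_and, Nat.succ_ne_zero] at h ⊢
      rcases Fin.exists_fin_two.1 ⟨α k, rfl⟩ with h' | h'
      · simpa [h'] using h.skip
      · simpa [h'] using h.app (by omega)

theorem Tail.exists_exponents {n k : ℕ} {ε : Bool} {t : R} (ht : Tail v n ε k t) :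
    ∃ α : ℕ → Fin 2, (∀ i, n ≤ i ∨ i < k → α i = 0) ∧ (α (n - 1) = 1 ↔ ε = true) ∧
      t = v n * ((List.range' k (n - k)).reverse.map fun i => v i ^ (α i : ℕ)).prod := by
  induction ht with
  | top => exact ⟨0, by simp, by simp, by simp⟩
  | @neck k h =>
    subst h
    exact ⟨fun i => if i = k then 1 else 0, fun i hi => if_neg (by omega), by simp, by simp⟩
  | @skip ε k t ht ih =>
    obtain ⟨α, h1, h2, rfl⟩ := ih
    have hk := ht.le
    refine ⟨α, fun i hi => h1 i (by omega), h2, ?_⟩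
    rw [show n - k = n - (k + 1) + 1 by omega, List.range'_succ]
    simp [h1 k]
  | @app ε k t hk ht ih =>
    obtain ⟨α, h1, h2, rfl⟩ := ih
    refine ⟨Function.update α k 1, fun i hi => ?_, ?_, ?_⟩
    · rw [Function.update_of_ne (by omega), h1 i (by omega)]
    · rw [Function.update_of_ne (by omega), h2]
    · rw [show n - k = n - (k + 1) + 1 by omega, List.range'_succ]
      simp only [List.reverse_cons, List.map_append, List.prod_append, List.map_cons, List.map_nil,
        List.prod_singleton, Function.update_self, Fin.val_one, pow_one, mul_assoc]
      congr 3
      refine List.map_congr_left fun i hi => ?_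
      rw [Function.update_of_ne]
      rintro rfl
      simp at hi

end Tails

/-! ### From words to the listed monomials -/

section Listed

variable {K : Type*} [Field K]

/-- The list of the letters of a monomial. -/
def Exponents.letterList (w : Exponents) : List ℕ := (List.range w.n).filter fun i => w.ξ i = 1

theorem Exponents.mem_letterList {w : Exponents} {i : ℕ} : i ∈ w.letterList ↔ w.ξ i = 1 := by
  simp only [letterList, List.mem_filter, List.mem_range, decide_eq_true_eq, and_iff_right_iff_imp]
  intro h
  by_contra hi
  rw [w.ξ_eq_zero i (by omega)] at h
  exact absurd h (by decide)

theorem monomial_eq (w : Exponents) :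
    monomial K w = letters (X K) w.letterList *
      (v K w.n * ((List.range' 0 w.n).reverse.map fun i => v K i ^ (w.α i : ℕ)).prod) := by
  rw [monomial, prod_map_pow, mul_assoc, Exponents.letterList, ← List.range_eq_range']; rfl

theorem Exponents.ξ_eq (w : Exponents) (i : ℕ) : w.ξ i = if i ∈ w.letterList then 1 else 0 := by
  simp only [mem_letterList]
  rcases Fin.exists_fin_two.1 ⟨w.ξ i, rfl⟩ with h | h <;> simp [h]

theorem listed_iff (w : Exponents) :
    Listed w ↔ Admissible w.n (w.n ≠ 0 ∧ w.α (w.n - 1) = 1 : Bool) w.letterList := by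
  have hlt : ∀ i ∈ w.letterList, i < w.n := fun i hi => by
    simp only [Exponents.letterList, List.mem_filter, List.mem_range] at hi
    exact hi.1
  simp only [Listed, Admissible, w.ξ_eq]
  rcases Fin.exists_fin_two.1 ⟨w.α (w.n - 1), rfl⟩ with h | h <;> simp only [h] <;>
    grind

theorem Listed.tail (w : Exponents) : Tail (v K) w.n (w.n ≠ 0 ∧ w.α (w.n - 1) = 1 : Bool) 0
    (v K w.n * ((List.range' 0 w.n).reverse.map fun i => v K i ^ (w.α i : ℕ)).prod) := by
  simpa using tail_of_exponents (v := v K) w.α w.n 0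

/-- Straightening yields words that need be neither sorted nor free of repetitions: a repeated
letter gives zero, and sorting costs at most a sign. -/
theorem letters_mul_tail_mem_span {n : ℕ} {ε : Bool} {l : List ℕ} {t : Module.End K (Grassmann K)}
    (hl : Admissible n ε l) (ht : Tail (v K) n ε 0 t) :
    letters (X K) l * t ∈ Submodule.span K (monomial K '' {w | Listed w}) := by
  by_cases hnd : l.Nodup
  swap
  · rw [(pivotSystem K).letters_eq_zero hnd, zero_mul]
    exact zero_mem _
  obtain ⟨α, h1, h2, rfl⟩ := ht.exists_exponents
  let w : Exponents :=
    { n := n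
      ξ := fun i => if i ∈ l then 1 else 0
      α := α
      ξ_eq_zero := fun i hi => if_neg fun h => absurd (hl.1 i h) (by omega)
      α_eq_zero := fun i hi => h1 i (Or.inl hi) }
  have hmem : ∀ i, i ∈ w.letterList ↔ i ∈ l := fun i => by
    rw [Exponents.mem_letterList]
    simp [w]
  have hp : l.Perm w.letterList :=
    (List.perm_ext_iff_of_nodup hnd (List.nodup_range.filter _)).2 fun i => (hmem i).symm
  -- For `n = 0` the index `n - 1` truncates to `0`, where the exponent vanishes.
  have hε : (n ≠ 0 ∧ α (n - 1) = 1 : Bool) = ε := by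
    rcases n.eq_zero_or_pos with rfl | hn
    · have := h1 0 (by simp)
      simp only [Nat.zero_sub, this] at h2
      cases ε <;> simp_all
    · have : n ≠ 0 := by omega
      cases ε <;> simp_all
  have hw : Listed w := by
    rw [listed_iff]
    change Admissible n (n ≠ 0 ∧ α (n - 1) = 1 : Bool) w.letterList
    rw [hε]
    simpa only [Admissible, hmem] using hl
  have hs : monomial K w ∈ Submodule.span K (monomial K '' {w | Listed w}) :=
    Submodule.subset_span ⟨w, hw, rfl⟩
  rw [monomial_eq] at hs
  exact (pivotSystem K).letters_mul_mem_of_perm hp hs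

theorem hull_le_span :
    (hull K).toSubmodule ≤ Submodule.span K (monomial K '' {w | Listed w}) := by
  refine ((pivotSystem K).adjoin_le_listedSpan (K := K)).trans (Submodule.span_le.2 ?_)
  rintro a ⟨n, ε, l, t, hl, ht, rfl⟩
  exact letters_mul_tail_mem_span hl ht

theorem monomial_mem_hull {w : Exponents} (hw : Listed w) (h : (2 : K) ≠ 0 ∨ NoNeck w) :
    monomial K w ∈ hull K := by
  have h0 : v K 0 ∈ hull K := NonUnitalAlgebra.subset_adjoin K (by simp)
  have h1 : v K 1 ∈ hull K := NonUnitalAlgebra.subset_adjoin K (by simp)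
  have hl := (listed_iff w).1 hw
  rw [monomial_eq]
  refine (pivotSystem K).letters_mul_tail_mem ((pivotSystem K).v_mem h0 h1) (h.imp_right ?_)
    hl (Listed.tail w)
  intro h hm
  have := hl.1 _ hm
  have h' := h (w.n - 1) (by omega)
  rw [Exponents.mem_letterList, h'] at hm
  exact absurd hm (by decide)

end Listed

end PivotHull

noncomputable section

namespace PivotHull

/-! ### Linear independence by weights -/

section Independence

/-- The sum of the powers of two with exponents in a list. -/
def twoPowSum (l : List ℕ) : ℕ := (l.map (2 ^ ·)).sum

variable (K : Type*) [Field K]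

/-- The product of Grassmann letters along a list. -/
def letterProd (l : List ℕ) : Grassmann K := (l.map (letter K)).prod

/-- The component of weight `m` of the Grassmann algebra, where `x_i` has weight `2^i`. -/
def weightSpace (m : ℤ) : Submodule K (Grassmann K) :=
  Submodule.span K {a | ∃ l, (twoPowSum l : ℤ) = m ∧ a = letterProd K l}

variable {K}

theorem letterProd_mem (l : List ℕ) : letterProd K l ∈ weightSpace K (twoPowSum l) :=
  Submodule.subset_span ⟨l, rfl, rfl⟩

theorem X_mem_weightSpace {m m' : ℤ} {i : ℕ} {a : Grassmann K} (h : m' = m + 2 ^ i)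
    (ha : a ∈ weightSpace K m) : X K i a ∈ weightSpace K m' := by
  induction ha using Submodule.span_induction with
  | mem a ha =>
    obtain ⟨l, rfl, rfl⟩ := ha
    exact Submodule.subset_span ⟨i :: l, by simp [h, twoPowSum, add_comm], by
      simp [letterProd, X]⟩
  | zero => rw [map_zero]; exact zero_mem _
  | add a b _ _ ha hb => rw [map_add]; exact add_mem ha hb
  | smul c a _ ha => rw [map_smul]; exact Submodule.smul_mem _ _ ha

theorem D_mem_weightSpace {m : ℤ} (i : ℕ) {a : Grassmann K} (ha : a ∈ weightSpace K m) :
    D K i a ∈ weightSpace K (m - 2 ^ i) := by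
  induction ha using Submodule.span_induction with
  | mem a ha =>
    obtain ⟨l, rfl, rfl⟩ := ha
    induction l with
    | nil => rw [letterProd, List.map_nil, List.prod_nil, D_one]; exact zero_mem _
    | cons j l ih =>
      have e : letterProd K (j :: l) = letter K j * letterProd K l := by simp [letterProd]
      rw [e, D_letter_mul]
      refine sub_mem ?_ (X_mem_weightSpace (i := j) ?_ ih)
      · split_ifs with h
        · subst h
          convert letterProd_mem (K := K) l using 1
          simp [twoPowSum]
        · exact zero_mem _
      · simp [twoPowSum]; ring
  | zero => rw [map_zero]; exact zero_mem _
  | add a b _ _ ha hb => rw [map_add]; exact add_mem ha hb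
  | smul c a _ ha => rw [map_smul]; exact Submodule.smul_mem _ _ ha

/-- All summands have the same weight, since `2^i + 2^(i+1) - 2^(i+2) = -2^i`. -/
theorem pivotTerm_mem_weightSpace {m : ℤ} {a : Grassmann K} (ha : a ∈ weightSpace K m) (k : ℕ) :
    ∀ i, pivotTerm K i k a ∈ weightSpace K (m - 2 ^ i) := by
  induction k with
  | zero => intro i; rw [pivotTerm_zero]; exact D_mem_weightSpace i ha
  | succ k ih =>
    intro i
    rw [pivotTerm_succ]
    exact X_mem_weightSpace (by ring_nf) (X_mem_weightSpace (i := i + 1) rfl (ih (i + 2)))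

theorem v_mem_weightSpace {m : ℤ} (i : ℕ) {a : Grassmann K} (ha : a ∈ weightSpace K m) :
    v K i a ∈ weightSpace K (m - 2 ^ i) := by
  rw [v_apply]
  exact finsum_induction (· ∈ weightSpace K (m - 2 ^ i)) (zero_mem _)
    (fun _ _ => add_mem) fun k => pivotTerm_mem_weightSpace ha k i

/-- The product of the pivot elements along the reversed list. -/
def pivotProd (K : Type*) [Field K] (l : List ℕ) : Module.End K (Grassmann K) :=
  (l.reverse.map (v K)).prod

theorem pivotProd_cons (i : ℕ) (l : List ℕ) : pivotProd K (i :: l) = pivotProd K l * v K i := by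
  simp [pivotProd]

theorem pivotProd_mem_weightSpace (l : List ℕ) : ∀ {m : ℤ} {a : Grassmann K},
    a ∈ weightSpace K m → pivotProd K l a ∈ weightSpace K (m - twoPowSum l) := by
  induction l with
  | nil => intro m a ha; simpa [pivotProd, twoPowSum] using ha
  | cons i l ih =>
    intro m a ha
    rw [pivotProd_cons, Module.End.mul_apply]
    convert ih (v_mem_weightSpace i ha) using 2
    simp [twoPowSum]; ring

theorem weightSpace_of_neg {m : ℤ} (hm : m < 0) : weightSpace K m = ⊥ := by
  rw [weightSpace, Submodule.span_eq_bot]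
  rintro a ⟨l, h, -⟩
  omega

theorem D_letterProd {i : ℕ} {l : List ℕ} (h : i ∉ l) : D K i (letterProd K l) = 0 := by
  induction l with
  | nil => exact D_one K i
  | cons j l ih =>
    simp only [List.mem_cons, not_or] at h
    have e : letterProd K (j :: l) = letter K j * letterProd K l := by simp [letterProd]
    rw [e, D_letter_mul, if_neg h.1, ih h.2, mul_zero, sub_zero]

/-- `v_i x_i = 1 - x_i ∂_i`, and `∂_i` kills the remaining word. -/
theorem v_letterProd_cons {i : ℕ} {l : List ℕ} (h : i ∉ l) :
    v K i (letterProd K (i :: l)) = letterProd K l := by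
  have e : letterProd K (i :: l) = X K i (letterProd K l) := by simp [letterProd, X]
  have h1 := LinearMap.congr_fun ((pivotSystem K).v_X i) (letterProd K l)
  have h2 := LinearMap.congr_fun ((pivotSystem K).X_v i) (letterProd K l)
  simp only [Module.End.mul_apply, LinearMap.sub_apply, Module.End.one_apply] at h1 h2
  rw [D_letterProd h, map_zero] at h2
  rw [e, h1, h2, sub_zero]

theorem pivotProd_letterProd {l : List ℕ} (h : l.Nodup) :
    pivotProd K l (letterProd K l) = 1 := by
  induction l with
  | nil => simp [pivotProd, letterProd]
  | cons i l ih =>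
    rw [List.nodup_cons] at h
    rw [pivotProd_cons, Module.End.mul_apply, v_letterProd_cons h.1, ih h.2]

theorem letters_one (l : List ℕ) : letters (X K) l 1 = letterProd K l := by
  induction l with
  | nil => simp [letterProd]
  | cons i l ih =>
    rw [letters_cons, Module.End.mul_apply, ih]
    simp [X, letterProd]

/-- The list of the indices of the pivot elements of a monomial. -/
def Exponents.pivotList (w : Exponents) : List ℕ :=
  (List.range w.n).filter (fun i => w.α i = 1) ++ [w.n]

theorem monomial_eq_pivotProd (w : Exponents) :
    monomial K w = letters (X K) w.letterList * pivotProd K w.pivotList := by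
  rw [monomial_eq, pivotProd, Exponents.pivotList, ← List.range_eq_range', prod_map_pow]
  simp [List.filter_reverse]

theorem Exponents.sortedLT_letterList (w : Exponents) : w.letterList.SortedLT :=
  (List.pairwise_lt_range.filter _).sortedLT

theorem Exponents.sortedLT_pivotList (w : Exponents) : w.pivotList.SortedLT := by
  refine List.Pairwise.sortedLT ?_
  rw [pivotList, List.pairwise_append]
  refine ⟨List.pairwise_lt_range.filter _, by simp, fun a ha b hb => ?_⟩
  simp at ha hb
  omega

theorem Exponents.ext_lists {w w' : Exponents} (hξ : w.letterList = w'.letterList)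
    (hα : w.pivotList = w'.pivotList) : w = w' := by
  have hn : w.n = w'.n := by
    have := congrArg List.getLast? hα
    simpa [pivotList] using this
  have hmem : ∀ (u : Exponents) (i : ℕ), i < u.n → (i ∈ u.pivotList ↔ u.α i = 1) :=
    fun u i hi => by simp [pivotList, hi, hi.ne]
  refine Exponents.ext hn (funext fun i => by rw [w.ξ_eq, w'.ξ_eq, hξ]) (funext fun i => ?_)
  by_cases hi : i < w.n
  · have h := hmem w i hi
    rw [hα, hmem w' i (hn ▸ hi)] at h
    rcases Fin.exists_fin_two.1 ⟨w.α i, rfl⟩ with e | e <;>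
      rcases Fin.exists_fin_two.1 ⟨w'.α i, rfl⟩ with e' | e' <;> simp_all
  · rw [w.α_eq_zero i (by omega), w'.α_eq_zero i (by omega)]

theorem twoPowSum_injOn {l l' : List ℕ} (hl : l.SortedLT) (hl' : l'.SortedLT)
    (h : twoPowSum l = twoPowSum l') : l = l' := by
  rw [← Nat.bitIndices_sum_map_two_pow hl, ← Nat.bitIndices_sum_map_two_pow hl']
  exact congrArg _ h

/-- The leading coefficient of `f` at the monomial `w`, as a scalar element of `Λ`. -/
def leadingValue (w : Exponents) (f : Module.End K (Grassmann K)) : Grassmann K :=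
  pivotProd K w.letterList (f (letterProd K w.pivotList))

theorem leadingValue_monomial_of_pivotList_eq {w w' : Exponents} (h : w'.pivotList = w.pivotList) :
    leadingValue w (monomial K w') = pivotProd K w.letterList (letterProd K w'.letterList) := by
  rw [leadingValue, monomial_eq_pivotProd, Module.End.mul_apply, h,
    pivotProd_letterProd w.sortedLT_pivotList.nodup, letters_one]

theorem leadingValue_monomial_self (w : Exponents) : leadingValue w (monomial K w) = 1 := by
  rw [leadingValue_monomial_of_pivotList_eq rfl,
    pivotProd_letterProd w.sortedLT_letterList.nodup]

/-- The result would have negative weight. -/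
theorem pivotProd_letterProd_of_lt {l l' : List ℕ} (h : twoPowSum l' < twoPowSum l) :
    pivotProd K l (letterProd K l') = 0 := by
  have := pivotProd_mem_weightSpace l (letterProd_mem (K := K) l')
  rwa [weightSpace_of_neg (by omega), Submodule.mem_bot] at this

/-- A heavier pivot product kills the test word. Equal pivot weights force equal pivot lists, which
turn the test word into `1`; then the letter weights decide. -/
theorem leadingValue_monomial_of_lt {w w' : Exponents}
    (h : twoPowSum w.pivotList < twoPowSum w'.pivotList ∨
      twoPowSum w.pivotList = twoPowSum w'.pivotList ∧
        twoPowSum w'.letterList < twoPowSum w.letterList) :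
    leadingValue w (monomial K w') = 0 := by
  rcases h with h | ⟨h, h'⟩
  · rw [leadingValue, monomial_eq_pivotProd, Module.End.mul_apply, pivotProd_letterProd_of_lt h,
      map_zero, map_zero]
  · rw [leadingValue_monomial_of_pivotList_eq
      (twoPowSum_injOn w'.sortedLT_pivotList w.sortedLT_pivotList h.symm),
      pivotProd_letterProd_of_lt h']

/-- All the formal monomials, listed or not, are linearly independent. -/
theorem linearIndependent_monomial : LinearIndependent K (monomial K) := by
  rw [linearIndependent_iff]
  intro c hc
  by_contra hne
  -- Least pivot weight and, among those, greatest letter weight: every other monomial of the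
  -- support then has leading value zero at `w`.
  obtain ⟨w, hw, hmin⟩ := c.support.exists_min_image
    (fun w => toLex ((twoPowSum w.pivotList : ℤ), -(twoPowSum w.letterList : ℤ)))
    (Finsupp.support_nonempty_iff.2 hne)
  have h : ∑ w' ∈ c.support, c w' • leadingValue w (monomial K w') = 0 := by
    have h0 : leadingValue w (Finsupp.linearCombination K (monomial K) c) = 0 := by
      rw [hc, leadingValue, LinearMap.zero_apply, map_zero]
    rw [Finsupp.linearCombination_apply, Finsupp.sum, leadingValue, LinearMap.sum_apply,
      map_sum] at h0
    rw [← h0]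
    exact Finset.sum_congr rfl fun w' _ => by
      rw [LinearMap.smul_apply, map_smul]; rfl
  rw [Finset.sum_eq_single_of_mem w hw, leadingValue_monomial_self] at h
  · exact Finsupp.mem_support_iff.1 hw ((smul_eq_zero.1 h).resolve_right one_ne_zero)
  · intro w' hw' hww'
    rw [leadingValue_monomial_of_lt, smul_zero]
    have := hmin w' hw'
    rw [Prod.Lex.toLex_le_toLex] at this
    rcases this with h | ⟨h, h'⟩
    · exact Or.inl (by simpa using h)
    · have h : twoPowSum w.pivotList = twoPowSum w'.pivotList := by simpa using h
      refine Or.inr ⟨h, lt_of_le_of_ne (by simpa using h') fun h2 => hww' ?_⟩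
      exact Exponents.ext_lists
        (twoPowSum_injOn w'.sortedLT_letterList w.sortedLT_letterList h2)
        (twoPowSum_injOn w'.sortedLT_pivotList w.sortedLT_pivotList h.symm)

end Independence

end PivotHull

end

theorem theorem8p1 (K : Type*) [Field K] :
    -- (i) in characteristic different from 2 the listed monomials form a basis of the hull
    (ringChar K ≠ 2 →
      LinearIndependent K
        (fun w : {w : PivotHull.Exponents // PivotHull.Listed w} => PivotHull.monomial K w.1) ∧
      Submodule.span K (PivotHull.monomial K '' {w | PivotHull.Listed w}) =
        (PivotHull.hull K).toSubmodule) ∧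
    -- (ii) in characteristic 2 the hull lies in the span of the listed monomials
    (ringChar K = 2 →
      (PivotHull.hull K).toSubmodule ≤
        Submodule.span K (PivotHull.monomial K '' {w | PivotHull.Listed w})) ∧
    -- (iii) over any field, the listed monomials with `ξ_{n-1} = 0`
    (LinearIndependent K
        (fun w : {w : PivotHull.Exponents // PivotHull.Listed w ∧ PivotHull.NoNeck w} =>
          PivotHull.monomial K w.1) ∧
      ∀ w : PivotHull.Exponents, PivotHull.Listed w → PivotHull.NoNeck w →
        PivotHull.monomial K w ∈ PivotHull.hull K) := by
  refine ⟨fun hK => ⟨?_, le_antisymm ?_ PivotHull.hull_le_span⟩, fun _ => PivotHull.hull_le_span,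
    ?_, fun w hw hn => PivotHull.monomial_mem_hull hw (Or.inr hn)⟩
  · exact PivotHull.linearIndependent_monomial.comp _ Subtype.val_injective
  · rw [Submodule.span_le]
    rintro _ ⟨w, hw, rfl⟩
    exact PivotHull.monomial_mem_hull hw (Or.inl (Ring.two_ne_zero hK))
  · exact PivotHull.linearIndependent_monomial.comp _ Subtype.val_injective
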